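/- Work over $\mathbb{Q}$. Let $\mathbf{Cat}\mathfrak{Lie}$ be the $\mathbb{Q}$-linear PROP associated to the Lie operad: its objects are the natural numbers and $$\mathbf{Cat}\mathfrak{Lie}(m,n)=\bigoplus_{f:\{1,\dots,m\}\twoheadrightarrow\{1,\dots,n\}}\ \bigotimes_{i=1}^{n}\mathfrak{Lie}(f^{-1}(i)),$$ the sum being over surjections. A left $\mathbf{Cat}\mathfrak{Lie}$-module is a $\mathbb{Q}$-linear functor from $\mathbf{Cat}\mathfrak{Lie}$ to $\mathbb{Q}$-vector spaces; $\delta$ denotes precomposition with $-\boxplus 1$, so $(\delta M)(n)=M(n+1)$. For $1\le i\le n$ let $\mu_i(n)\in\mathbf{Cat}\mathfrak{Lie}(n+1,n)$ be the generator (given by the bracket $[i,n+1]$ in the $i$-th output and by identities in the others) of the summand indexed by the surjection that is the identity on $\{1,\dots,n\}$ and sends $n+1$ to $i$, and let $\mu(n)=\sum_{i=1}^n\mu_i(n)$ (so $\mu(0)=0$). The action of the elements $\mu(n)$ defines a natural transformation $\widetilde\mu:\delta\to\mathrm{Id}$ of endofunctors of left $\mathbf{Cat}\mathfrak{Lie}$-modules,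 with $\widetilde\mu:(\delta M)(n)=M(n+1)\to M(n)$. Let $\mathcal{F}_{\mathfrak{Lie}}^{\mu}$ be the full subcategory of the left $\mathbf{Cat}\mathfrak{Lie}$-modules $M$ for which $\widetilde\mu:\delta M\to M$ is zero. Let $\delta^{(1)}\mathbf{Cat}\mathfrak{Lie}(m,n)\subset\delta\mathbf{Cat}\mathfrak{Lie}(m,n)=\mathbf{Cat}\mathfrak{Lie}(m,n+1)$ be the sum of the terms indexed by the surjections $f:\{1,\dots,m\}\twoheadrightarrow\{1,\dots,n+1\}$ with $|f^{-1}(n+1)|=1$; it is stable under the left action of $\mathbf{Cat}\mathfrak{Lie}$ on $\delta\mathbf{Cat}\mathfrak{Lie}$. Let $\widetilde\mu^{(1)}:\delta^{(1)}\mathbf{Cat}\mathfrak{Lie}\to\mathbf{Cat}\mathfrak{Lie}$ be the restriction of $\widetilde\mu$, and let $\mathbf{H}_0,\mathbf{H}_1$ be the homology, in degrees $0$ and $1$, of the complex of left $\mathbf{Cat}\mathfrak{Lie}$-modules underlying $\mathbb{C}\mathfrak{Lie}$, namely $$\mathbb{C}\mathfrak{Lie}=\bigl(\delta^{(1)}\mathbf{Cat}\mathfrak{Lie}\xrightarrow{\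 \widetilde\mu^{(1)}\ }\mathbf{Cat}\mathfrak{Lie}\bigr),$$ with $\mathbf{Cat}\mathfrak{Lie}$ in degree $0$ and $\delta^{(1)}\mathbf{Cat}\mathfrak{Lie}$ in degree $1$. **Corollary.** Considered as a left $\mathbf{Cat}\mathfrak{Lie}$-module, $\mathbf{H}_1$ belongs to $\mathcal{F}_{\mathfrak{Lie}}^{\mu}$; that is, for every $m\in\mathbb{N}$ the functor $n\mapsto\mathbf{H}_1(m,n)$ is a left $\mathbf{Cat}\mathfrak{Lie}$-module on which $\widetilde\mu$ is zero. -/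

import Mathlib

open CategoryTheory

noncomputable section

namespace LieProp

/-! ### Forests of bracketings: the free PROP on one binary operation -/

/-- The multiset of leaves of a binary tree. -/
def leaves {α : Type} : FreeMagma α → Multiset α
  | .of a => {a}
  | .mul x y => leaves x + leaves y

@[simp] lemma leaves_of {α : Type} (a : α) : leaves (FreeMagma.of a) = {a} := rfl

@[simp] lemma leaves_mul {α : Type} (x y : FreeMagma α) :
    leaves (x * y) = leaves x + leaves y := rfl

/-- A forest with inputs `1, …, m` and outputs `1, …, n`: an `n`-tuple of binary trees (iterated
bracketings) such that each of the `m` inputs labels exactly one leaf of exactly one tree.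
Sending an input to the index of the tree it belongs to gives a surjection `f` from `Fin m` to
`Fin n`, and the `i`-th tree is a multilinear bracketing of the elements of the fibre
`f⁻¹(i)`. -/
@[ext] structure Forest (m n : ℕ) where
  tree : Fin n → FreeMagma (Fin m)
  leaves_eq : ∑ j, leaves (tree j) = Finset.univ.val

lemma leaves_lift {α β : Type} (f : α → FreeMagma β) (t : FreeMagma α) :
    leaves (FreeMagma.lift f t) = ((leaves t).map fun a => leaves (f a)).sum := by
  induction t using FreeMagma.recOnMul with
  | ih1 x => simp
  | ih2 x y hx hy => simp [hx, hy]

lemma lift_lift {α β γ : Type} (f : α → FreeMagma β) (g : β → FreeMagma γ) (t : FreeMagma α) :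
    FreeMagma.lift g (FreeMagma.lift f t) =
      FreeMagma.lift (fun a => FreeMagma.lift g (f a)) t := by
  induction t using FreeMagma.recOnMul with
  | ih1 x => simp
  | ih2 x y hx hy => simp [hx, hy]

lemma lift_of_self {α : Type} (t : FreeMagma α) : FreeMagma.lift FreeMagma.of t = t := by
  induction t using FreeMagma.recOnMul with
  | ih1 x => simp
  | ih2 x y hx hy => simp [hx, hy]

lemma lift_congr {α β : Type} {f g : α → FreeMagma β} (t : FreeMagma α)
    (h : ∀ a ∈ leaves t, f a = g a) : FreeMagma.lift f t = FreeMagma.lift g t := by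
  induction t using FreeMagma.recOnMul with
  | ih1 x => simpa using h x (by simp)
  | ih2 x y hx hy =>
    rw [map_mul, map_mul, hx fun a ha => h a (by simp [ha]), hy fun a ha => h a (by simp [ha])]

namespace Forest

lemma sum_map {k n : ℕ} (g : Forest k n) {M : Type} [AddCommMonoid M] (F : Fin k → M) :
    ∑ j, ((leaves (g.tree j)).map F).sum = ∑ i, F i := by
  have h : ∑ j, ((leaves (g.tree j)).map F).sum = ((∑ j, leaves (g.tree j)).map F).sum := by
    exact (map_sum (Multiset.sumAddMonoidHom.comp (Multiset.mapAddMonoidHom F))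
      (fun j => leaves (g.tree j)) Finset.univ).symm
  rw [h, g.leaves_eq]
  rfl

lemma sum_leaves_lift {k m n : ℕ} (g : Forest k n) (v : Fin k → FreeMagma (Fin m)) :
    ∑ j, leaves (FreeMagma.lift v (g.tree j)) = ∑ i, leaves (v i) := by
  simp only [leaves_lift]
  exact g.sum_map fun i => leaves (v i)

/-- Grafting of forests: the inputs of `g` are replaced by the trees of `f`. This is the composite
`g ∘ f` in the free PROP. -/
def graft {m k n : ℕ} (g : Forest k n) (f : Forest m k) : Forest m n where
  tree j := FreeMagma.lift f.tree (g.tree j)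
  leaves_eq := by rw [g.sum_leaves_lift, f.leaves_eq]

@[simp] lemma graft_tree {m k n : ℕ} (g : Forest k n) (f : Forest m k) (j : Fin n) :
    (g.graft f).tree j = FreeMagma.lift f.tree (g.tree j) := rfl

/-- The identity forest. -/
def one (n : ℕ) : Forest n n where
  tree j := FreeMagma.of j
  leaves_eq := by simp [Finset.sum_multiset_singleton]

lemma graft_assoc {m k l n : ℕ} (h : Forest l n) (g : Forest k l) (f : Forest m k) :
    (h.graft g).graft f = h.graft (g.graft f) := by
  ext j
  simp [lift_lift]
  rfl

lemma graft_one {m n : ℕ} (g : Forest m n) : g.graft (one m) = g := by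
  ext j
  exact lift_of_self _

lemma one_graft {m n : ℕ} (f : Forest m n) : (one n).graft f = f := by
  ext j
  rfl

/-- `f ⊠ 1`: add one new last input and one new last output, joined to each other. -/
def shift {m n : ℕ} (f : Forest m n) : Forest (m + 1) (n + 1) where
  tree := Fin.snoc (α := fun _ => FreeMagma (Fin (m + 1)))
    (fun j => FreeMagma.map Fin.castSucc (f.tree j)) (FreeMagma.of (Fin.last m))
  leaves_eq := by
    have h : ∀ t : FreeMagma (Fin m),
        leaves (FreeMagma.map Fin.castSucc t) = (leaves t).map Fin.castSucc := by
      intro t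
      induction t using FreeMagma.recOnMul with
      | ih1 x => simp
      | ih2 x y hx hy => simp [hx, hy]
    have h2 : ∑ j, (leaves (f.tree j)).map Fin.castSucc =
        (∑ j, leaves (f.tree j)).map Fin.castSucc := by
      exact (map_sum (Multiset.mapAddMonoidHom Fin.castSucc)
        (fun j => leaves (f.tree j)) Finset.univ).symm
    rw [Fin.sum_univ_castSucc]
    simp only [Fin.snoc_castSucc, Fin.snoc_last, h, h2, f.leaves_eq, leaves_of]
    rw [← Finset.sum_multiset_singleton (Finset.univ : Finset (Fin (m + 1))),
      Fin.sum_univ_castSucc]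
    congr 1
    rw [← Finset.sum_multiset_singleton (Finset.univ : Finset (Fin m))]
    simpa using (map_sum (Multiset.mapAddMonoidHom (Fin.castSucc (n := m)))
        (fun j => {j}) Finset.univ)

@[simp] lemma shift_castSucc {m n : ℕ} (f : Forest m n) (j : Fin n) :
    f.shift.tree j.castSucc = FreeMagma.map Fin.castSucc (f.tree j) := by
  simp [shift]

@[simp] lemma shift_last {m n : ℕ} (f : Forest m n) :
    f.shift.tree (Fin.last n) = FreeMagma.of (Fin.last m) := by
  simp [shift]

lemma lift_map {α β γ : Type} (f : α → β) (g : β → FreeMagma γ) (t : FreeMagma α) :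
    FreeMagma.lift g (FreeMagma.map f t) = FreeMagma.lift (fun a => g (f a)) t := by
  induction t using FreeMagma.recOnMul with
  | ih1 x => simp
  | ih2 x y hx hy => simp [hx, hy]

lemma map_lift {α β γ : Type} (f : α → FreeMagma β) (g : β → γ) (t : FreeMagma α) :
    FreeMagma.map g (FreeMagma.lift f t) = FreeMagma.lift (fun a => FreeMagma.map g (f a)) t := by
  induction t using FreeMagma.recOnMul with
  | ih1 x => simp
  | ih2 x y hx hy => simp [hx, hy]

lemma shift_graft {m k n : ℕ} (g : Forest k n) (f : Forest m k) :
    (g.graft f).shift = g.shift.graft f.shift := by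
  ext j
  refine Fin.lastCases ?_ (fun j => ?_) j
  · simp
  · simp [lift_map, map_lift]

lemma shift_one (n : ℕ) : (one n).shift = one (n + 1) := by
  ext j
  refine Fin.lastCases ?_ (fun j => ?_) j
  · simp [one]
  · simp [one]

/-- The forest with inputs `1, …, n + 1` and outputs `1, …, n` whose `i`-th tree is the bracket
`[i, n + 1]` and whose other trees are single leaves. The corresponding surjection restricts to
the identity on `{1, …, n}` and sends `n + 1` to `i`. -/
def mu {n : ℕ} (i : Fin n) : Forest (n + 1) n where
  tree j := if j = i then FreeMagma.of j.castSucc * FreeMagma.of (Fin.last n)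
    else FreeMagma.of j.castSucc
  leaves_eq := by
    have h : ∀ j : Fin n, leaves (if j = i then
        FreeMagma.of j.castSucc * FreeMagma.of (Fin.last n) else FreeMagma.of j.castSucc) =
        {j.castSucc} + if j = i then {Fin.last n} else 0 := by
      intro j
      split_ifs <;> simp
    simp only [h, Finset.sum_add_distrib, Finset.sum_ite_eq', Finset.mem_univ, if_true]
    rw [← Finset.sum_multiset_singleton (Finset.univ : Finset (Fin (n + 1))),
      Fin.sum_univ_castSucc]

end Forest

/-! ### The PROP of the Lie operad -/

/-- The relators of the Lie operad: antisymmetry `[a, b] + [b, a]` and the Jacobi relation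
`[[a, b], c] + [[b, c], a] + [[c, a], b]`, placed at an arbitrary vertex of a forest (the forests
`p, q, r` agree outside their `i`-th tree, and are grafted on the forest `g`). -/
inductive IsRelator {m n : ℕ} : (Forest m n →₀ ℚ) → Prop
  | antisymm {k : ℕ} (g : Forest k n) (i : Fin k) (a b : FreeMagma (Fin m)) (p q : Forest m k)
      (hp : p.tree i = a * b) (hq : q.tree i = b * a)
      (hpq : ∀ l, l ≠ i → q.tree l = p.tree l) :
      IsRelator (Finsupp.single (g.graft p) 1 + Finsupp.single (g.graft q) 1)
  | jacobi {k : ℕ} (g : Forest k n) (i : Fin k) (a b c : FreeMagma (Fin m)) (p q r : Forest m k)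
      (hp : p.tree i = (a * b) * c) (hq : q.tree i = (b * c) * a) (hr : r.tree i = (c * a) * b)
      (hpq : ∀ l, l ≠ i → q.tree l = p.tree l) (hpr : ∀ l, l ≠ i → r.tree l = p.tree l) :
      IsRelator (Finsupp.single (g.graft p) 1 + Finsupp.single (g.graft q) 1 +
        Finsupp.single (g.graft r) 1)

/-- The span of the relators. -/
def relations (m n : ℕ) : Submodule ℚ (Forest m n →₀ ℚ) :=
  Submodule.span ℚ {x | IsRelator x}

/-- The morphisms of the PROP of the Lie operad,
`⨁_{f : m ↠ n} ⨂_{i = 1}^{n} Lie(f⁻¹(i))`: linear combinations of forests modulo antisymmetry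
and the Jacobi relation. In particular `LieHom m 1` is `Lie(m)`. -/
abbrev LieHom (m n : ℕ) : Type := (Forest m n →₀ ℚ) ⧸ relations m n

/-- The class of a forest. -/
def cls {m n : ℕ} (f : Forest m n) : LieHom m n := (relations m n).mkQ (Finsupp.single f 1)

lemma LieHom.hom_ext {m n : ℕ} {M : Type} [AddCommGroup M] [Module ℚ M]
    {φ ψ : LieHom m n →ₗ[ℚ] M} (h : ∀ f, φ (cls f) = ψ (cls f)) : φ = ψ := by
  apply Submodule.linearMap_qext
  exact Finsupp.lhom_ext' fun f => LinearMap.ext_ring (h f)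

lemma LieHom.induction {m n : ℕ} {P : LieHom m n → Prop} (x : LieHom m n)
    (zero : P 0) (basis : ∀ f, P (cls f)) (add : ∀ x y, P x → P y → P (x + y))
    (smul : ∀ (r : ℚ) x, P x → P (r • x)) : P x := by
  obtain ⟨y, rfl⟩ := (relations m n).mkQ_surjective x
  induction y using Finsupp.induction_linear with
  | zero => simpa using zero
  | add a b ha hb => simpa using add _ _ ha hb
  | single f r =>
    have : Finsupp.single f r = r • Finsupp.single f (1 : ℚ) := by simp
    rw [this, map_smul]
    exact smul _ _ (basis f)

/-- Bilinear extension of grafting to linear combinations of forests, with values in `LieHom`. -/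
def preComp (m k n : ℕ) : (Forest m k →₀ ℚ) →ₗ[ℚ] (Forest k n →₀ ℚ) →ₗ[ℚ] LieHom m n :=
  Finsupp.linearCombination ℚ fun f => Finsupp.linearCombination ℚ fun g => cls (g.graft f)

@[simp] lemma preComp_single {m k n : ℕ} (f : Forest m k) (g : Forest k n) :
    preComp m k n (Finsupp.single f 1) (Finsupp.single g 1) = cls (g.graft f) := by
  simp [preComp]

lemma mkQ_relator {m n : ℕ} {x : Forest m n →₀ ℚ} (hx : IsRelator x) :
    (relations m n).mkQ x = 0 := by
  rw [Submodule.mkQ_apply, Submodule.Quotient.mk_eq_zero]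
  exact Submodule.subset_span hx

lemma cls_antisymm {m k n : ℕ} (g : Forest k n) (i : Fin k) (a b : FreeMagma (Fin m))
    (p q : Forest m k) (hp : p.tree i = a * b) (hq : q.tree i = b * a)
    (hpq : ∀ l, l ≠ i → q.tree l = p.tree l) :
    cls (g.graft p) + cls (g.graft q) = 0 := by
  have := mkQ_relator (.antisymm g i a b p q hp hq hpq)
  rwa [map_add] at this

lemma cls_jacobi {m k n : ℕ} (g : Forest k n) (i : Fin k) (a b c : FreeMagma (Fin m))
    (p q r : Forest m k) (hp : p.tree i = (a * b) * c) (hq : q.tree i = (b * c) * a)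
    (hr : r.tree i = (c * a) * b)
    (hpq : ∀ l, l ≠ i → q.tree l = p.tree l) (hpr : ∀ l, l ≠ i → r.tree l = p.tree l) :
    cls (g.graft p) + cls (g.graft q) + cls (g.graft r) = 0 := by
  have := mkQ_relator (.jacobi g i a b c p q r hp hq hr hpq hpr)
  rwa [map_add, map_add] at this

lemma lift_graft_congr {l m k : ℕ} {f : Forest l m} {p q : Forest m k} {i : Fin k}
    (h : ∀ l, l ≠ i → q.tree l = p.tree l) :
    ∀ l, l ≠ i → (q.graft f).tree l = (p.graft f).tree l := by
  intro l hl
  simp [h l hl]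

/-- Composition in the PROP of the Lie operad, in diagrammatic order. -/
def comp (m k n : ℕ) : LieHom m k →ₗ[ℚ] LieHom k n →ₗ[ℚ] LieHom m n :=
  (preComp m k n).liftQ₂ (relations m k) (relations k n)
    (by
      refine Submodule.span_le.2 fun x hx => ?_
      change preComp m k n x = 0
      refine Finsupp.lhom_ext' fun h => LinearMap.ext_ring ?_
      cases hx with
      | antisymm g i a b p q hp hq hpq =>
        simpa [← Forest.graft_assoc] using cls_antisymm (h.graft g) i a b p q hp hq hpq
      | jacobi g i a b c p q r hp hq hr hpq hpr =>
        simpa [← Forest.graft_assoc] using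
          cls_jacobi (h.graft g) i a b c p q r hp hq hr hpq hpr)
    (by
      refine Submodule.span_le.2 fun x hx => ?_
      change (preComp m k n).flip x = 0
      refine Finsupp.lhom_ext' fun f => LinearMap.ext_ring ?_
      cases hx with
      | antisymm g i a b p q hp hq hpq =>
        simpa [Forest.graft_assoc] using
          cls_antisymm g i (FreeMagma.lift f.tree a) (FreeMagma.lift f.tree b)
            (p.graft f) (q.graft f) (by simp [hp]) (by simp [hq]) (lift_graft_congr hpq)
      | jacobi g i a b c p q r hp hq hr hpq hpr =>
        simpa [Forest.graft_assoc] using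
          cls_jacobi g i (FreeMagma.lift f.tree a) (FreeMagma.lift f.tree b)
            (FreeMagma.lift f.tree c) (p.graft f) (q.graft f) (r.graft f) (by simp [hp])
            (by simp [hq]) (by simp [hr]) (lift_graft_congr hpq) (lift_graft_congr hpr))

@[simp] lemma comp_cls {m k n : ℕ} (f : Forest m k) (g : Forest k n) :
    comp m k n (cls f) (cls g) = cls (g.graft f) :=
  preComp_single f g

lemma comp_assoc {m k l n : ℕ} (x : LieHom m k) (y : LieHom k l) (z : LieHom l n) :
    comp m l n (comp m k l x y) z = comp m k n x (comp k l n y z) := by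
  induction x using LieHom.induction with
  | zero => simp
  | add x x' h h' => simp only [map_add, LinearMap.add_apply, h, h']
  | smul r x h => simp only [map_smul, LinearMap.smul_apply, h]
  | basis f =>
    induction y using LieHom.induction with
    | zero => simp
    | add x x' h h' => simp only [map_add, LinearMap.add_apply, h, h']
    | smul r x h => simp only [map_smul, LinearMap.smul_apply, h]
    | basis g =>
      induction z using LieHom.induction with
      | zero => simp
      | add x x' h h' => simp only [map_add, h, h']
      | smul r x h => simp only [map_smul, h]
      | basis h => simp [Forest.graft_assoc]

lemma one_comp {m n : ℕ} (x : LieHom m n) : comp m m n (cls (Forest.one m)) x = x := by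
  have : comp m m n (cls (Forest.one m)) = LinearMap.id :=
    LieHom.hom_ext fun f => by simp [Forest.graft_one]
  simp [this]

lemma comp_one {m n : ℕ} (x : LieHom m n) : comp m n n x (cls (Forest.one n)) = x := by
  have : (comp m n n).flip (cls (Forest.one n)) = LinearMap.id :=
    LieHom.hom_ext fun f => by simp [Forest.one_graft]
  exact LinearMap.congr_fun this x

lemma comp_add_left {m k n : ℕ} (x x' : LieHom m k) (y : LieHom k n) :
    comp m k n (x + x') y = comp m k n x y + comp m k n x' y := by
  rw [map_add, LinearMap.add_apply]

lemma comp_add_right {m k n : ℕ} (x : LieHom m k) (y y' : LieHom k n) :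
    comp m k n x (y + y') = comp m k n x y + comp m k n x y' :=
  map_add _ _ _

lemma comp_smul_left {m k n : ℕ} (r : ℚ) (x : LieHom m k) (y : LieHom k n) :
    comp m k n (r • x) y = r • comp m k n x y := by
  rw [map_smul, LinearMap.smul_apply]

lemma comp_smul_right {m k n : ℕ} (r : ℚ) (x : LieHom m k) (y : LieHom k n) :
    comp m k n x (r • y) = r • comp m k n x y :=
  map_smul _ _ _

/-- `φ ↦ φ ⊠ 1`. -/
def shiftHom (m n : ℕ) : LieHom m n →ₗ[ℚ] LieHom (m + 1) (n + 1) :=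
  (relations m n).liftQ (Finsupp.linearCombination ℚ fun f => cls f.shift) (by
    have hs {k : ℕ} {p q : Forest m k} {i : Fin k} (h : ∀ l, l ≠ i → q.tree l = p.tree l) :
        ∀ l, l ≠ i.castSucc → q.shift.tree l = p.shift.tree l := by
      intro l
      refine Fin.lastCases ?_ (fun l => ?_) l
      · simp
      · intro hl
        simp [h l (by rintro rfl; exact hl rfl)]
    refine Submodule.span_le.2 fun x hx => ?_
    change Finsupp.linearCombination ℚ (fun f : Forest m n => cls f.shift) x = 0
    cases hx with
    | antisymm g i a b p q hp hq hpq =>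
      simpa [Forest.shift_graft] using
        cls_antisymm g.shift i.castSucc (FreeMagma.map Fin.castSucc a)
          (FreeMagma.map Fin.castSucc b) p.shift q.shift (by simp [hp]) (by simp [hq]) (hs hpq)
    | jacobi g i a b c p q r hp hq hr hpq hpr =>
      simpa [Forest.shift_graft] using
        cls_jacobi g.shift i.castSucc (FreeMagma.map Fin.castSucc a)
          (FreeMagma.map Fin.castSucc b) (FreeMagma.map Fin.castSucc c) p.shift q.shift r.shift
          (by simp [hp]) (by simp [hq]) (by simp [hr]) (hs hpq) (hs hpr))

@[simp] lemma shiftHom_cls {m n : ℕ} (f : Forest m n) : shiftHom m n (cls f) = cls f.shift := by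
  have : Finsupp.linearCombination ℚ (fun f : Forest m n => cls f.shift) (Finsupp.single f 1) =
    cls f.shift := by simp
  exact this

lemma shiftHom_comp {m k n : ℕ} (x : LieHom m k) (y : LieHom k n) :
    shiftHom m n (comp m k n x y) =
      comp (m + 1) (k + 1) (n + 1) (shiftHom m k x) (shiftHom k n y) := by
  induction x using LieHom.induction with
  | zero => simp
  | add x x' h h' => simp only [map_add, LinearMap.add_apply, h, h']
  | smul r x h => simp only [map_smul, LinearMap.smul_apply, h]
  | basis f =>
    induction y using LieHom.induction with
    | zero => simp
    | add x x' h h' => simp only [map_add, h, h']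
    | smul r x h => simp only [map_smul, h]
    | basis g => simp [Forest.shift_graft]

/-- The element `μ(n)`, the sum of the forests `Forest.mu i` over the surjections from `n + 1` to
`n` that restrict to the identity of `{1, …, n}`. In particular `μ(0) = 0`. -/
def mu (n : ℕ) : LieHom (n + 1) n := ∑ i, cls (Forest.mu i)

/-! ### Centrality of the elements `μ(n)` -/

open Classical in
/-- The class of a tuple of trees, zero if it is not a forest. -/
def clsTuple {m n : ℕ} (v : Fin n → FreeMagma (Fin m)) : LieHom m n :=
  if h : ∑ j, leaves (v j) = Finset.univ.val then cls ⟨v, h⟩ else 0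

lemma clsTuple_tree {m n : ℕ} (f : Forest m n) : clsTuple f.tree = cls f :=
  dif_pos f.leaves_eq

/-- The class of the tuple obtained by grafting on `g` the trees `p`, with `u` at place `i`. -/
def ctx {m k n : ℕ} (g : Forest k n) (p : Fin k → FreeMagma (Fin m)) (i : Fin k)
    (u : FreeMagma (Fin m)) : LieHom m n :=
  clsTuple fun j => FreeMagma.lift (Function.update p i u) (g.tree j)

lemma ctx_of {m k n : ℕ} (g : Forest k n) (p : Fin k → FreeMagma (Fin m)) (i : Fin k)
    (u : FreeMagma (Fin m)) (h : ∑ l, leaves (Function.update p i u l) = Finset.univ.val) :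
    ctx g p i u = cls (g.graft ⟨_, h⟩) :=
  clsTuple_tree (g.graft ⟨_, h⟩)

lemma ctx_of_not {m k n : ℕ} (g : Forest k n) (p : Fin k → FreeMagma (Fin m)) (i : Fin k)
    (u : FreeMagma (Fin m)) (h : ¬ ∑ l, leaves (Function.update p i u l) = Finset.univ.val) :
    ctx g p i u = 0 :=
  dif_neg (by rwa [g.sum_leaves_lift])

lemma leaves_update {m k : ℕ} (p : Fin k → FreeMagma (Fin m)) (i : Fin k)
    {u v : FreeMagma (Fin m)} (h : leaves u = leaves v) (l : Fin k) :
    leaves (Function.update p i u l) = leaves (Function.update p i v l) := by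
  by_cases hl : l = i
  · subst hl
    simp [h]
  · simp [hl]

lemma ctx_antisymm {m k n : ℕ} (g : Forest k n) (p : Fin k → FreeMagma (Fin m)) (i : Fin k)
    (a b : FreeMagma (Fin m)) : ctx g p i (a * b) = -ctx g p i (b * a) := by
  have e := leaves_update p i (u := b * a) (v := a * b) (by simp [add_comm])
  by_cases h : ∑ l, leaves (Function.update p i (a * b) l) = Finset.univ.val
  · have h' : ∑ l, leaves (Function.update p i (b * a) l) = Finset.univ.val := by
      simpa only [e] using h
    rw [ctx_of _ _ _ _ h, ctx_of _ _ _ _ h', eq_neg_iff_add_eq_zero]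
    exact cls_antisymm g i a b _ _ (by simp) (by simp) (fun l hl => by simp [hl])
  · have h' : ¬ ∑ l, leaves (Function.update p i (b * a) l) = Finset.univ.val := by
      simpa only [e] using h
    rw [ctx_of_not _ _ _ _ h, ctx_of_not _ _ _ _ h', neg_zero]

lemma ctx_jacobi {m k n : ℕ} (g : Forest k n) (p : Fin k → FreeMagma (Fin m)) (i : Fin k)
    (a b c : FreeMagma (Fin m)) :
    ctx g p i (a * b * c) + ctx g p i (b * c * a) + ctx g p i (c * a * b) = 0 := by
  have e := leaves_update p i (u := b * c * a) (v := a * b * c) (by simp; abel)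
  have e2 := leaves_update p i (u := c * a * b) (v := a * b * c) (by simp; abel)
  by_cases h : ∑ l, leaves (Function.update p i (a * b * c) l) = Finset.univ.val
  · have h' : ∑ l, leaves (Function.update p i (b * c * a) l) = Finset.univ.val := by
      simpa only [e] using h
    have h2 : ∑ l, leaves (Function.update p i (c * a * b) l) = Finset.univ.val := by
      simpa only [e2] using h
    rw [ctx_of _ _ _ _ h, ctx_of _ _ _ _ h', ctx_of _ _ _ _ h2]
    exact cls_jacobi g i a b c _ _ _ (by simp) (by simp) (by simp) (fun l hl => by simp [hl])
      (fun l hl => by simp [hl])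
  · have h' : ¬ ∑ l, leaves (Function.update p i (b * c * a) l) = Finset.univ.val := by
      simpa only [e] using h
    have h2 : ¬ ∑ l, leaves (Function.update p i (c * a * b) l) = Finset.univ.val := by
      simpa only [e2] using h
    rw [ctx_of_not _ _ _ _ h, ctx_of_not _ _ _ _ h', ctx_of_not _ _ _ _ h2]
    simp

lemma ctx_mul {m k n : ℕ} (g : Forest k n) (p : Fin k → FreeMagma (Fin m)) (i : Fin k)
    (u b : FreeMagma (Fin m)) :
    ctx g p i (u * b) = ctx (g.graft (Forest.mu i))
      (Fin.snoc (α := fun _ => FreeMagma (Fin m)) p b) i.castSucc u := by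
  unfold ctx
  congr 1
  funext j
  rw [Forest.graft_tree, lift_lift]
  refine lift_congr _ fun l _ => ?_
  by_cases hl : l = i
  · subst hl
    simp [Forest.mu, Function.update_of_ne (Fin.castSucc_lt_last l).ne']
  · simp [Forest.mu, hl]

/-- In the Lie operad, bracketing with `x` on the right is a derivation. -/
lemma ctx_derivation {m n : ℕ} (σ : Fin n → FreeMagma (Fin m)) (x : FreeMagma (Fin m))
    (T : FreeMagma (Fin n)) (hT : (leaves T).Nodup) {k t : ℕ} (g : Forest k t)
    (p : Fin k → FreeMagma (Fin m)) (j : Fin k) :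
    ((leaves T).map fun i =>
      ctx g p j (FreeMagma.lift (Function.update σ i (σ i * x)) T)).sum =
      ctx g p j (FreeMagma.lift σ T * x) := by
  induction T using FreeMagma.recOnMul generalizing k with
  | ih1 i => simp
  | ih2 A B hA hB =>
    rw [leaves_mul, Multiset.nodup_add] at hT
    obtain ⟨h1, h2, h3⟩ := hT
    have e1 : ∀ i ∈ leaves A,
        ctx g p j (FreeMagma.lift (Function.update σ i (σ i * x)) (A * B)) =
        ctx (g.graft (Forest.mu j))
          (Fin.snoc (α := fun _ => FreeMagma (Fin m)) p (FreeMagma.lift σ B)) j.castSucc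
          (FreeMagma.lift (Function.update σ i (σ i * x)) A) := by
      intro i hi
      rw [← ctx_mul, map_mul, lift_congr (f := Function.update σ i (σ i * x)) (g := σ) B]
      intro l hl
      refine Function.update_of_ne ?_ _ _
      rintro rfl
      exact Multiset.disjoint_left.1 h3 hi hl
    have e2 : ∀ i ∈ leaves B,
        ctx g p j (FreeMagma.lift (Function.update σ i (σ i * x)) (A * B)) =
        -ctx (g.graft (Forest.mu j))
          (Fin.snoc (α := fun _ => FreeMagma (Fin m)) p (FreeMagma.lift σ A)) j.castSucc
          (FreeMagma.lift (Function.update σ i (σ i * x)) B) := by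
      intro i hi
      rw [← ctx_mul, ← ctx_antisymm, map_mul,
        lift_congr (f := Function.update σ i (σ i * x)) (g := σ) A]
      intro l hl
      refine Function.update_of_ne ?_ _ _
      rintro rfl
      exact Multiset.disjoint_left.1 h3 hl hi
    rw [leaves_mul, Multiset.map_add, Multiset.sum_add, Multiset.map_congr rfl e1,
      Multiset.map_congr rfl e2, Multiset.sum_map_neg, hA h1, hB h2, ← ctx_mul, ← ctx_mul,
      map_mul]
    have J := ctx_jacobi g p j (FreeMagma.lift σ A) (FreeMagma.lift σ B) x
    have S : ctx g p j (x * FreeMagma.lift σ A * FreeMagma.lift σ B) =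
        -ctx g p j (FreeMagma.lift σ A * x * FreeMagma.lift σ B) := by
      rw [ctx_mul, ctx_mul g p j (FreeMagma.lift σ A * x), ctx_antisymm]
    rw [S] at J
    rw [← sub_eq_zero, ← neg_eq_zero, ← J]
    abel

lemma mu_tree {n : ℕ} (i : Fin n) : (Forest.mu i).tree =
    Function.update (fun j : Fin n => FreeMagma.of j.castSucc) i
      (FreeMagma.of i.castSucc * FreeMagma.of (Fin.last n)) := by
  funext j
  by_cases h : j = i
  · subst h
    simp [Forest.mu]
  · simp [Forest.mu, h]

/-- The elements `μ(n)` are central. -/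
lemma mu_central {n t : ℕ} (x : LieHom n t) :
    comp (n + 1) n t (mu n) x = comp (n + 1) (t + 1) t (shiftHom n t x) (mu t) := by
  induction x using LieHom.induction with
  | zero => simp
  | add x x' h h' => simp only [map_add, LinearMap.add_apply, h, h']
  | smul r x h => simp only [map_smul, LinearMap.smul_apply, h]
  | basis w =>
    have nd : ∀ j, (leaves (w.tree j)).Nodup := by
      intro j
      refine Multiset.nodup_of_le ?_ (Finset.univ : Finset (Fin n)).nodup
      rw [← w.leaves_eq]
      exact Finset.single_le_sum (f := fun j => leaves (w.tree j))
        (fun _ _ => Multiset.zero_le _) (Finset.mem_univ j)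
    have disj : ∀ i j l, i ∈ leaves (w.tree j) → i ∈ leaves (w.tree l) → l = j := by
      intro i j l hj hl
      by_contra hne
      have hle : leaves (w.tree l) + leaves (w.tree j) ≤ Finset.univ.val := by
        rw [← w.leaves_eq, ← Finset.sum_pair (f := fun j => leaves (w.tree j)) hne]
        exact Finset.sum_le_sum_of_subset (Finset.subset_univ _)
      have := Multiset.nodup_of_le hle (Finset.univ : Finset (Fin n)).nodup
      exact Multiset.disjoint_left.1 (Multiset.nodup_add.1 this).2.2 hl hj
    set σ : Fin n → FreeMagma (Fin (n + 1)) := fun j => FreeMagma.of j.castSucc with hσ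
    have e : ∀ j, ∀ i ∈ leaves (w.tree j), cls (w.graft (Forest.mu i)) =
        ctx (Forest.one t) (fun l => FreeMagma.lift σ (w.tree l)) j
          (FreeMagma.lift (Function.update σ i (σ i * FreeMagma.of (Fin.last n))) (w.tree j)) := by
      intro j i hi
      rw [← clsTuple_tree]
      unfold ctx
      congr 1
      funext l
      simp only [Forest.graft_tree, Forest.one, FreeMagma.lift_of, mu_tree]
      by_cases hl : l = j
      · subst hl
        simp [hσ]
      · rw [Function.update_of_ne hl]
        refine lift_congr _ fun a ha => Function.update_of_ne ?_ _ _
        rintro rfl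
        exact hl (disj _ _ _ hi ha)
    simp only [mu, map_sum, LinearMap.sum_apply, comp_cls, shiftHom_cls]
    rw [← w.sum_map]
    refine Finset.sum_congr rfl fun j _ => ?_
    rw [Multiset.map_congr rfl (e j), ctx_derivation σ _ _ (nd j), ← clsTuple_tree]
    unfold ctx
    congr 1
    funext l
    by_cases hl : l = j
    · subst hl
      simp [Forest.one, Forest.mu, FreeMagma.map, hσ, Function.comp_def]
    · simp [Forest.one, Forest.mu, hl, FreeMagma.map, hσ, Function.comp_def]

/-! ### The category, its left modules, and the natural transformation `μ̃` -/

/-- The `ℚ`-linear category (PROP) associated to the Lie operad; its objects are the natural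
numbers. -/
@[ext] structure CatLie where
  arity : ℕ

instance : Category CatLie where
  Hom m n := LieHom m.arity n.arity
  id m := cls (Forest.one m.arity)
  comp f g := comp _ _ _ f g
  id_comp f := one_comp f
  comp_id f := comp_one f
  assoc f g h := comp_assoc f g h

instance : Preadditive CatLie where
  homGroup m n := inferInstanceAs (AddCommGroup (LieHom m.arity n.arity))
  add_comp _ _ _ f f' g := comp_add_left f f' g
  comp_add _ _ _ f g g' := comp_add_right f g g'

instance : CategoryTheory.Linear ℚ CatLie where
  homModule m n := inferInstanceAs (Module ℚ (LieHom m.arity n.arity))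
  smul_comp _ _ _ r f g := comp_smul_left r f g
  comp_smul _ _ _ f r g := comp_smul_right r f g

/-- The functor `- ⊠ 1`. -/
def shift : CatLie ⥤ CatLie where
  obj n := ⟨n.arity + 1⟩
  map f := shiftHom _ _ f
  map_id n := by
    change shiftHom _ _ (cls (Forest.one n.arity)) = cls (Forest.one (n.arity + 1))
    rw [shiftHom_cls, Forest.shift_one]
  map_comp f g := shiftHom_comp f g

/-- The elements `μ(n) ∈ CatLie(n + 1, n)` form a natural transformation. -/
def muNat : shift ⟶ 𝟭 CatLie where
  app n := mu n.arity
  naturality _ _ f := (mu_central f).symm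

/-- A functor from `CatLie` to `ℚ`-vector spaces is a left `CatLie`-module (an object of `F_Lie`)
if it is `ℚ`-linear. -/
def IsLeftModule : ObjectProperty (CatLie ⥤ ModuleCat.{0} ℚ) :=
  fun M => M.Additive ∧ M.Linear ℚ

/-- The shift functor `δ`, given by precomposition with `- ⊠ 1`, so `(δ M)(n) = M(n + 1)`. -/
def delta : (CatLie ⥤ ModuleCat.{0} ℚ) ⥤ (CatLie ⥤ ModuleCat.{0} ℚ) :=
  (Functor.whiskeringLeft _ _ _).obj shift

/-- The natural transformation `μ̃ : δ ⟶ Id`, given at `M` and `n` by the action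
`M(n + 1) ⟶ M(n)` of `μ(n)`. -/
def muTilde : delta ⟶ 𝟭 (CatLie ⥤ ModuleCat.{0} ℚ) where
  app M := { app := fun n => M.map (muNat.app n)
             naturality := fun _ _ f => by
              change M.map _ ≫ M.map _ = M.map _ ≫ M.map _
              rw [← M.map_comp, ← M.map_comp, muNat.naturality]
              rfl }
  naturality M N f := by
    ext n : 2
    exact (f.naturality (muNat.app n)).symm

/-- The full subcategory `F_Lie^μ` of the left `CatLie`-modules on which `μ̃` is zero. -/
def FLieMu : ObjectProperty (CatLie ⥤ ModuleCat.{0} ℚ) :=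
  fun M => IsLeftModule M ∧ muTilde.app M = 0

/-! ### The complex and its homology -/

/-- The subspace `δ⁽¹⁾CatLie(m, n)` of `δCatLie(m, n) = CatLie(m, n + 1)`: the sum of the terms
indexed by the surjections for which the fibre of `n + 1` has exactly one element, i.e. the span
of the forests whose last tree is a single leaf. -/
def deltaOneSub (m n : ℕ) : Submodule ℚ (LieHom m (n + 1)) :=
  Submodule.span ℚ {x | ∃ f : Forest m (n + 1), (∃ a, f.tree (Fin.last n) = FreeMagma.of a) ∧
    x = cls f}

lemma comp_shift_mem {m n t : ℕ} (x : LieHom n t) {y : LieHom m (n + 1)}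
    (hy : y ∈ deltaOneSub m n) : comp _ _ _ y (shiftHom n t x) ∈ deltaOneSub m t := by
  induction x using LieHom.induction with
  | zero => simp
  | add x x' h h' => simpa only [map_add] using add_mem h h'
  | smul r x h => simpa only [map_smul] using Submodule.smul_mem _ r h
  | basis g =>
    induction hy using Submodule.span_induction with
    | zero => simp
    | add x x' _ _ h h' => simpa only [map_add, LinearMap.add_apply] using add_mem h h'
    | smul r x _ h =>
      simpa only [map_smul, LinearMap.smul_apply] using Submodule.smul_mem _ r h
    | mem y hy =>
      obtain ⟨f, ⟨a, ha⟩, rfl⟩ := hy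
      rw [shiftHom_cls, comp_cls]
      exact Submodule.subset_span ⟨_, ⟨a, by simp [ha]⟩, rfl⟩

/-- The left `CatLie`-module `CatLie(m, -)`. -/
abbrev catLieLeft (m : CatLie) : CatLie ⥤ ModuleCat.{0} ℚ :=
  (linearCoyoneda ℚ CatLie).obj (Opposite.op m)

/-- The left `CatLie`-module `δ⁽¹⁾CatLie(m, -)`, a submodule of `δCatLie(m, -)`. -/
def deltaOne (m : CatLie) : CatLie ⥤ ModuleCat.{0} ℚ where
  obj n := ModuleCat.of ℚ (deltaOneSub m.arity n.arity)
  map {n t} f := ModuleCat.ofHom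
    ((((comp _ _ _).flip (shiftHom n.arity t.arity f)).restrict fun _ => comp_shift_mem f))
  map_id n := by
    ext x
    exact (congrArg (comp _ _ _ x.1) (shift.map_id n)).trans (comp_one _)
  map_comp f g := by
    ext x
    exact (congrArg (comp _ _ _ x.1) (shift.map_comp f g)).trans (comp_assoc _ _ _).symm

/-- The inclusion of `δ⁽¹⁾CatLie(m, -)` in `δCatLie(m, -)`. -/
def deltaOneIncl (m : CatLie) : deltaOne m ⟶ delta.obj (catLieLeft m) where
  app n := ModuleCat.ofHom (deltaOneSub m.arity n.arity).subtype

/-- The differential `μ̃⁽¹⁾`, the restriction of `μ̃ : δCatLie ⟶ CatLie` to `δ⁽¹⁾CatLie`. -/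
def muTildeOne (m : CatLie) : deltaOne m ⟶ catLieLeft m :=
  deltaOneIncl m ≫ muTilde.app (catLieLeft m)

/-- The complex of left `CatLie`-modules `ℂLie(m, -)` underlying `ℂLie`, with `CatLie(m, -)` in
degree `0`, `δ⁽¹⁾CatLie(m, -)` in degree `1`, zero elsewhere, and differential `μ̃⁽¹⁾`. The left
action of the degree `0` part `CatLie` of `ℂLie` by composition in `ℂLie` is this one. -/
def cLie (m : CatLie) : ChainComplex (CatLie ⥤ ModuleCat.{0} ℚ) ℕ :=
  HomologicalComplex.double (muTildeOne m) (c := ComplexShape.down ℕ) (i₀ := 1) (i₁ := 0)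
    (by simp)

/-- The left `CatLie`-module `H_i(m, -)`, where `H` is the homology of `ℂLie`. -/
def homologyLie (i : ℕ) (m : CatLie) : CatLie ⥤ ModuleCat.{0} ℚ := (cLie m).homology i

end LieProp

end

noncomputable section

namespace LieProp

attribute [local instance] LieRing.ofAssociativeRing

/-! ### Evaluation of bracketings in a Lie algebra -/

/-! In degree one the homology is a quotient of the cycles, and the cycles embed in the kernel of
`muTildeOne m`. By naturality of `muTilde` it is enough that `muTilde` kills this kernel. This
follows from a linear factorisation: for each `n` there is `κ` with `κ (d y) = μ̃ y` for all `y` in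
`deltaOneSub m (n + 1)` (`exists_homotopy`).

To find `κ`, let `L` be the free Lie algebra on the inputs and view a forest as a tuple of elements
of `L`. A generator `y` is `(w₁, …, wₙ, b, a)` with `a` a single input. Its differential is the sum
of the tuples `(w₁, …, [wᵢ, a], …, wₙ, b)` plus `(w, [b, a])`, while `μ̃ y` is the sum of the tuples
`(w₁, …, [wᵢ, b], …, wₙ, a)`. Put `κ(w, b) = h(b)(w)`, where `h` is a 1-cocycle on `L` with values
in the linear maps from `L^{⊗n}` to `LieHom m (n + 1)`, the target having trivial action. Since `L`
is free, `h` may be prescribed on generators by `h(a)(w) = (w, a)` and exists (`exists_cocycle`).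
The cocycle rule `h([b, a])(w) = h(b)(a·w) - h(a)(b·w)` cancels the first sum, which is
`-h(b)(a·w)`, and leaves `-(b·w, a)`, that is, `μ̃ y`.

The passage between forests and tuples has two directions. `evalHom` sends classes of forests to
values of multilinear maps on a Lie algebra; `exists_clsForm` gives a multilinear map on `L` that
returns the class of a forest from the values of its trees. -/

/-- The value of a bracketing in a Lie ring, given the values of its leaves. -/
def evalTree {α L : Type} [LieRing L] (v : α → L) : FreeMagma α → L
  | .of a => v a
  | .mul x y => ⁅evalTree v x, evalTree v y⁆

section evalTree

variable {α β L : Type} [LieRing L]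

@[simp] lemma evalTree_of (v : α → L) (a : α) : evalTree v (FreeMagma.of a) = v a := rfl

@[simp] lemma evalTree_mul (v : α → L) (x y : FreeMagma α) :
    evalTree v (x * y) = ⁅evalTree v x, evalTree v y⁆ := rfl

lemma evalTree_lift (v : β → L) (p : α → FreeMagma β) (T : FreeMagma α) :
    evalTree v (FreeMagma.lift p T) = evalTree (fun a => evalTree v (p a)) T := by
  induction T using FreeMagma.recOnMul with
  | ih1 x => simp
  | ih2 x y hx hy => simp [hx, hy]

lemma evalTree_congr {v w : α → L} (T : FreeMagma α) (h : ∀ a ∈ leaves T, v a = w a) :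
    evalTree v T = evalTree w T := by
  induction T using FreeMagma.recOnMul with
  | ih1 x => simpa using h x (by simp)
  | ih2 x y hx hy =>
    rw [evalTree_mul, evalTree_mul, hx fun a ha => h a (by simp [ha]),
      hy fun a ha => h a (by simp [ha])]

/-- A leaf that occurs exactly once enters an iterated bracket through a composite of maps `± ad`,
which is linear. -/
lemma exists_linear_evalTree_update [LieAlgebra ℚ L] [DecidableEq α] (v : α → L) (i : α)
    (T : FreeMagma α) (hT : (leaves T).Nodup) (hi : i ∈ leaves T) :
    ∃ φ : L →ₗ[ℚ] L, ∀ u, evalTree (Function.update v i u) T = φ u := by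
  induction T using FreeMagma.recOnMul with
  | ih1 x =>
    obtain rfl : i = x := by simpa using hi
    exact ⟨LinearMap.id, fun u => by simp⟩
  | ih2 x y hx hy =>
    rw [leaves_mul, Multiset.nodup_add] at hT
    obtain ⟨h1, h2, h3⟩ := hT
    have key : ∀ S : FreeMagma α, i ∉ leaves S →
        ∀ u, evalTree (Function.update v i u) S = evalTree v S := fun S hS u =>
      evalTree_congr S fun a ha => Function.update_of_ne (by rintro rfl; exact hS ha) _ _
    rw [leaves_mul, Multiset.mem_add] at hi
    rcases hi with hi | hi
    · obtain ⟨φ, hφ⟩ := hx h1 hi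
      -- The variable is in the left factor, so moving it to the right of the bracket costs a sign.
      refine ⟨-(LieAlgebra.ad ℚ L (evalTree v y)).comp φ, fun u => ?_⟩
      rw [evalTree_mul, hφ, key y (Multiset.disjoint_left.1 h3 hi)]
      simp
    · obtain ⟨φ, hφ⟩ := hy h2 hi
      refine ⟨(LieAlgebra.ad ℚ L (evalTree v x)).comp φ, fun u => ?_⟩
      rw [evalTree_mul, hφ, key x fun h => Multiset.disjoint_left.1 h3 h hi]
      simp

end evalTree

/-! ### Each input of a forest is a leaf of exactly one tree -/

namespace Forest

lemma nodup_leaves {m n : ℕ} (f : Forest m n) (j : Fin n) : (leaves (f.tree j)).Nodup := by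
  refine Multiset.nodup_of_le ?_ (Finset.univ : Finset (Fin m)).nodup
  rw [← f.leaves_eq]
  exact Finset.single_le_sum (f := fun j => leaves (f.tree j))
    (fun _ _ => Multiset.zero_le _) (Finset.mem_univ j)

lemma eq_of_mem_leaves {m n : ℕ} (f : Forest m n) {i : Fin m} {j l : Fin n}
    (hj : i ∈ leaves (f.tree j)) (hl : i ∈ leaves (f.tree l)) : l = j := by
  by_contra hne
  have hle : leaves (f.tree l) + leaves (f.tree j) ≤ Finset.univ.val := by
    rw [← f.leaves_eq, ← Finset.sum_pair (f := fun j => leaves (f.tree j)) hne]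
    exact Finset.sum_le_sum_of_subset (Finset.subset_univ _)
  have := Multiset.nodup_of_le hle (Finset.univ : Finset (Fin m)).nodup
  exact Multiset.disjoint_left.1 (Multiset.nodup_add.1 this).2.2 hl hj

lemma exists_mem_leaves {m n : ℕ} (f : Forest m n) (i : Fin m) :
    ∃ j, i ∈ leaves (f.tree j) := by
  have : i ∈ ∑ j, leaves (f.tree j) := by rw [f.leaves_eq]; exact Finset.mem_univ i
  simpa [Multiset.mem_sum] using this

end Forest

/-! ### Maps out of the PROP defined by a Lie algebra -/

section descend

variable {L M : Type} [LieRing L] [LieAlgebra ℚ L] [AddCommGroup M] [Module ℚ M]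

/-- Only the tree containing the input `i` changes, and it changes linearly. This lets a relator
buried inside a forest be evaluated by adding the values at its vertex. -/
lemma exists_linear_evalForest_update {k n : ℕ} (Ψ : MultilinearMap ℚ (fun _ : Fin n => L) M)
    (g : Forest k n) (v : Fin k → L) (i : Fin k) :
    ∃ φ : L →ₗ[ℚ] M, ∀ u,
      Ψ (fun j => evalTree (Function.update v i u) (g.tree j)) = φ u := by
  obtain ⟨j, hj⟩ := g.exists_mem_leaves i
  obtain ⟨φ, hφ⟩ := exists_linear_evalTree_update v i (g.tree j) (g.nodup_leaves j) hj
  refine ⟨(Ψ.toLinearMap (fun l => evalTree v (g.tree l)) j).comp φ, fun u => ?_⟩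
  rw [LinearMap.comp_apply, MultilinearMap.toLinearMap_apply, ← hφ]
  congr 1
  funext l
  by_cases hl : l = j
  · subst hl
    simp
  · rw [Function.update_of_ne hl]
    refine evalTree_congr _ fun a ha => Function.update_of_ne ?_ _ _
    rintro rfl
    exact hl (g.eq_of_mem_leaves hj ha)

/-- The linear map on `LieHom m n` obtained by evaluating the `n` trees of a forest in a Lie
algebra and applying a multilinear map. -/
def evalHom {m n : ℕ} (v : Fin m → L) (Ψ : MultilinearMap ℚ (fun _ : Fin n => L) M) :
    LieHom m n →ₗ[ℚ] M :=
  (relations m n).liftQ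
    (Finsupp.linearCombination ℚ fun f => Ψ fun j => evalTree v (f.tree j)) (by
    -- All forests of a relator are compared with one reference forest `r`, from which they differ
    -- only in slot `i`.
    have key {k : ℕ} (p : Forest m k) (i : Fin k) (u : L)
        (h : evalTree v (p.tree i) = u) (r : Forest m k)
        (hr : ∀ l, l ≠ i → p.tree l = r.tree l) (g : Forest k n) :
        (fun j => evalTree v ((g.graft p).tree j)) = fun j =>
          evalTree (Function.update (fun l => evalTree v (r.tree l)) i u) (g.tree j) := by
      funext j
      rw [Forest.graft_tree, evalTree_lift]
      refine evalTree_congr _ fun l _ => ?_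
      by_cases hl : l = i
      · subst hl
        simp [h]
      · simp [hl, hr l hl]
    refine Submodule.span_le.2 fun x hx => ?_
    change Finsupp.linearCombination ℚ
      (fun f : Forest m n => Ψ fun j => evalTree v (f.tree j)) x = 0
    cases hx with
    | antisymm g i a b p q hp hq hpq =>
      obtain ⟨φ, hφ⟩ := exists_linear_evalForest_update Ψ g (fun l => evalTree v (p.tree l)) i
      have e1 := key p i _ rfl p (fun _ _ => rfl) g
      have e2 := key q i _ rfl p hpq g
      rw [map_add, Finsupp.linearCombination_single, Finsupp.linearCombination_single, e1, e2, hφ,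
        hφ, hp, hq, one_smul, one_smul, ← map_add, evalTree_mul, evalTree_mul, ← lie_skew,
        neg_add_cancel, map_zero]
    | jacobi g i a b c p q r hp hq hr hpq hpr =>
      obtain ⟨φ, hφ⟩ := exists_linear_evalForest_update Ψ g (fun l => evalTree v (p.tree l)) i
      have e1 := key p i _ rfl p (fun _ _ => rfl) g
      have e2 := key q i _ rfl p hpq g
      have e3 := key r i _ rfl p hpr g
      rw [map_add, map_add, Finsupp.linearCombination_single, Finsupp.linearCombination_single,
        Finsupp.linearCombination_single, e1, e2, e3, hφ, hφ, hφ, hp, hq, hr, one_smul, one_smul,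
        one_smul, ← map_add, ← map_add]
      simp only [evalTree_mul]
      have J := lie_jacobi (evalTree v a) (evalTree v b) (evalTree v c)
      -- The relators bracket from the left and `lie_jacobi` from the right; antisymmetry turns one
      -- into the negative of the other.
      rw [← lie_skew ⁅evalTree v a, evalTree v b⁆, ← lie_skew ⁅evalTree v b, evalTree v c⁆,
        ← lie_skew ⁅evalTree v c, evalTree v a⁆]
      rw [← map_zero φ]
      congr 1
      rw [← neg_eq_zero, ← J]
      abel)

lemma evalHom_cls {m n : ℕ} (v : Fin m → L) (Ψ : MultilinearMap ℚ (fun _ : Fin n => L) M)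
    (f : Forest m n) : evalHom v Ψ (cls f) = Ψ fun j => evalTree v (f.tree j) := by
  have : Finsupp.linearCombination ℚ (fun f : Forest m n => Ψ fun j => evalTree v (f.tree j))
      (Finsupp.single f 1) = Ψ fun j => evalTree v (f.tree j) := by simp
  exact this

end descend

/-! ### Free Lie algebras and multilinear maps to the PROP -/

section FreeLie

variable {α : Type}

lemma freeNonAssoc_induction {P : FreeNonUnitalNonAssocAlgebra ℚ α → Prop}
    (x : FreeNonUnitalNonAssocAlgebra ℚ α) (zero : P 0)
    (add : ∀ x y, P x → P y → P (x + y)) (smul : ∀ (r : ℚ) x, P x → P (r • x))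
    (tree : ∀ T : FreeMagma α, P (MonoidAlgebra.single T 1)) : P x := by
  induction x using MonoidAlgebra.induction_linear with
  | zero => exact zero
  | add x y hx hy => exact add x y hx hy
  | single T r =>
    have : MonoidAlgebra.single T r = r • MonoidAlgebra.single T (1 : ℚ) := by simp
    rw [this]
    exact smul r _ (tree T)

variable (α) in
/-- The quotient map onto the free Lie algebra, as a linear map. -/
def toFreeLie : FreeNonUnitalNonAssocAlgebra ℚ α →ₗ[ℚ] FreeLieAlgebra ℚ α where
  toFun := Quot.mk (FreeLieAlgebra.Rel ℚ α)
  map_add' _ _ := rfl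
  map_smul' _ _ := rfl

lemma toFreeLie_surjective : Function.Surjective (toFreeLie α) := Quot.mk_surjective

lemma toFreeLie_mul (x y : FreeNonUnitalNonAssocAlgebra ℚ α) :
    toFreeLie α (x * y) = ⁅toFreeLie α x, toFreeLie α y⁆ := rfl

lemma toFreeLie_single (T : FreeMagma α) :
    toFreeLie α (MonoidAlgebra.single T 1) = evalTree (FreeLieAlgebra.of ℚ) T := by
  induction T using FreeMagma.recOnMul with
  | ih1 x => rfl
  | ih2 x y hx hy =>
    rw [evalTree_mul, ← hx, ← hy, ← toFreeLie_mul, MonoidAlgebra.single_mul_single, one_mul]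

lemma freeLie_induction {P : FreeLieAlgebra ℚ α → Prop} (x : FreeLieAlgebra ℚ α) (zero : P 0)
    (add : ∀ x y, P x → P y → P (x + y)) (smul : ∀ (r : ℚ) x, P x → P (r • x))
    (of : ∀ a, P (FreeLieAlgebra.of ℚ a)) (lie : ∀ x y, P x → P y → P ⁅x, y⁆) : P x := by
  obtain ⟨y, rfl⟩ := toFreeLie_surjective x
  induction y using freeNonAssoc_induction with
  | zero => simpa using zero
  | add x y hx hy => simpa using add _ _ hx hy
  | smul r x hx => simpa using smul r _ hx
  | tree T =>
    rw [toFreeLie_single]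
    induction T using FreeMagma.recOnMul with
    | ih1 a => exact of a
    | ih2 x y hx hy => exact lie _ _ hx hy

end FreeLie

/-! ### Descent of a single slot to the free Lie algebra -/

section ctxHom

variable {m k n : ℕ}

/-- The linear extension of `ctx g p i`. -/
def ctxHom (g : Forest k n) (p : Fin k → FreeMagma (Fin m)) (i : Fin k) :
    FreeNonUnitalNonAssocAlgebra ℚ (Fin m) →ₗ[ℚ] LieHom m n :=
  (MonoidAlgebra.basis (FreeMagma (Fin m)) ℚ).constr ℚ (ctx g p i)

@[simp] lemma ctxHom_single (g : Forest k n) (p : Fin k → FreeMagma (Fin m)) (i : Fin k)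
    (T : FreeMagma (Fin m)) : ctxHom g p i (MonoidAlgebra.single T 1) = ctx g p i T := by
  rw [ctxHom, ← MonoidAlgebra.basis_apply, Module.Basis.constr_basis]

/-- A right factor can be absorbed into the surrounding forest: `b` becomes one more grafted tree,
and `Forest.mu i` brackets it with slot `i`. -/
lemma ctxHom_mul_single (g : Forest k n) (p : Fin k → FreeMagma (Fin m)) (i : Fin k)
    (x : FreeNonUnitalNonAssocAlgebra ℚ (Fin m)) (b : FreeMagma (Fin m)) :
    ctxHom g p i (x * MonoidAlgebra.single b 1) = ctxHom (g.graft (Forest.mu i))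
      (Fin.snoc (α := fun _ => FreeMagma (Fin m)) p b) i.castSucc x := by
  induction x using freeNonAssoc_induction with
  | zero => simp
  | add x y hx hy => rw [add_mul, map_add, map_add, hx, hy]
  | smul r x hx => rw [smul_mul_assoc, map_smul, map_smul, hx]
  | tree T => simp [MonoidAlgebra.single_mul_single, ctx_mul]

lemma ctxHom_antisymm (g : Forest k n) (p : Fin k → FreeMagma (Fin m)) (i : Fin k)
    (x y : FreeNonUnitalNonAssocAlgebra ℚ (Fin m)) :
    ctxHom g p i (x * y) = -ctxHom g p i (y * x) := by
  induction x using freeNonAssoc_induction with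
  | zero => simp
  | add x x' hx hy => rw [add_mul, mul_add, map_add, map_add, hx, hy, neg_add]
  | smul r x hx => rw [smul_mul_assoc, mul_smul_comm, map_smul, map_smul, hx, smul_neg]
  | tree a =>
    induction y using freeNonAssoc_induction with
    | zero => simp
    | add x x' hx hy => rw [add_mul, mul_add, map_add, map_add, hx, hy, neg_add]
    | smul r x hx => rw [smul_mul_assoc, mul_smul_comm, map_smul, map_smul, hx, smul_neg]
    | tree b => simpa [MonoidAlgebra.single_mul_single] using ctx_antisymm g p i a b

lemma ctxHom_jacobi (g : Forest k n) (p : Fin k → FreeMagma (Fin m)) (i : Fin k)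
    (x y z : FreeNonUnitalNonAssocAlgebra ℚ (Fin m)) :
    ctxHom g p i (x * y * z + y * z * x + z * x * y) = 0 := by
  induction x using freeNonAssoc_induction with
  | zero => simp
  | add x x' hx hy =>
    -- The target `0` is split as `0 + 0`, and each summand is replaced by the expression that an
    -- induction hypothesis kills.
    rw [← add_zero (0 : LieHom m n)]
    nth_rw 1 [← hx]
    rw [← hy, ← map_add]
    congr 1
    simp only [add_mul, mul_add]
    abel
  | smul r x hx =>
    simp only [smul_mul_assoc, mul_smul_comm, ← smul_add, map_smul, hx, smul_zero]
  | tree a =>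
    induction y using freeNonAssoc_induction with
    | zero => simp
    | add x x' hx hy =>
      rw [← add_zero (0 : LieHom m n)]
      nth_rw 1 [← hx]
      rw [← hy, ← map_add]
      congr 1
      simp only [add_mul, mul_add]
      abel
    | smul r x hx =>
      simp only [smul_mul_assoc, mul_smul_comm, ← smul_add, map_smul, hx, smul_zero]
    | tree b =>
      induction z using freeNonAssoc_induction with
      | zero => simp
      | add x x' hx hy =>
        rw [← add_zero (0 : LieHom m n)]
        nth_rw 1 [← hx]
        rw [← hy, ← map_add]
        congr 1
        simp only [add_mul, mul_add]
        abel
      | smul r x hx =>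
        simp only [smul_mul_assoc, mul_smul_comm, ← smul_add, map_smul, hx, smul_zero]
      | tree c => simpa [MonoidAlgebra.single_mul_single] using ctx_jacobi g p i a b c

/-- The context is quantified after the relation because closure under right multiplication enlarges
it; left multiplication then reduces to right multiplication by antisymmetry. -/
lemma ctxHom_eq_of_rel {x y : FreeNonUnitalNonAssocAlgebra ℚ (Fin m)}
    (h : FreeLieAlgebra.Rel ℚ (Fin m) x y) :
    ∀ {k : ℕ} (g : Forest k n) (p : Fin k → FreeMagma (Fin m)) (i : Fin k),
      ctxHom g p i x = ctxHom g p i y := by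
  have mul_right {a b : FreeNonUnitalNonAssocAlgebra ℚ (Fin m)}
      (h : ∀ {k : ℕ} (g : Forest k n) (p : Fin k → FreeMagma (Fin m)) (i : Fin k),
        ctxHom g p i a = ctxHom g p i b) (c : FreeNonUnitalNonAssocAlgebra ℚ (Fin m)) {k : ℕ}
      (g : Forest k n) (p : Fin k → FreeMagma (Fin m)) (i : Fin k) :
      ctxHom g p i (a * c) = ctxHom g p i (b * c) := by
    induction c using freeNonAssoc_induction with
    | zero => simp
    | add x y hx hy => rw [mul_add, mul_add, map_add, map_add, hx, hy]
    | smul r x hx => rw [mul_smul_comm, mul_smul_comm, map_smul, map_smul, hx]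
    | tree T => rw [ctxHom_mul_single, ctxHom_mul_single, h]
  induction h with
  | lie_self a =>
    intro k g p i
    rw [map_zero]
    -- Antisymmetry only gives that the value equals its own negative; over `ℚ` this forces it to
    -- vanish.
    have := IsAddTorsionFree.of_module_rat (M := LieHom m n)
    exact self_eq_neg.1 (ctxHom_antisymm g p i a a)
  | leibniz_lie a b c =>
    intro k g p i
    have J := ctxHom_jacobi g p i a b c
    have h1 : ctxHom g p i (a * c * b) = ctxHom g p i (-(c * a) * b) :=
      mul_right (fun g p i => by rw [map_neg, ctxHom_antisymm]) b g p i
    rw [neg_mul, map_neg] at h1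
    rw [map_add, map_add] at J
    rw [map_add, ctxHom_antisymm g p i a, ctxHom_antisymm g p i b, h1, neg_neg, ← sub_eq_zero,
      ← neg_eq_zero, ← J]
    abel
  | smul t _ h => intro k g p i; rw [map_smul, map_smul, h]
  | add_right c _ h => intro k g p i; rw [map_add, map_add, h]
  | mul_left a _ h =>
    intro k g p i
    rw [ctxHom_antisymm, ctxHom_antisymm g p i a, mul_right h]
  | mul_right c _ h => exact mul_right h c

lemma ctxHom_eq_zero {x : FreeNonUnitalNonAssocAlgebra ℚ (Fin m)} (hx : toFreeLie (Fin m) x = 0)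
    (g : Forest k n) (p : Fin k → FreeMagma (Fin m)) (i : Fin k) : ctxHom g p i x = 0 := by
  have h : Quot.mk (FreeLieAlgebra.Rel ℚ (Fin m)) x = Quot.mk _ 0 := hx
  rw [← map_zero (ctxHom g p i)]
  exact congrArg (Quot.lift (ctxHom g p i) fun _ _ h => ctxHom_eq_of_rel h g p i) h

end ctxHom

/-! ### Descent of all slots to the free Lie algebra -/

lemma _root_.MultilinearMap.map_comp_eq_of_update_eq {ι R V W : Type*} [Fintype ι] [DecidableEq ι]
    [Ring R] [AddCommGroup V] [Module R V] [AddCommGroup W] [Module R W]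
    (f : MultilinearMap R (fun _ : ι => V) W) (F : V → V)
    (h : ∀ v i, f (Function.update v i (F (v i))) = f v) (v : ι → V) :
    f (fun i => F (v i)) = f v := by
  -- The slots are replaced one at a time, so the intermediate tuples are mixed.
  suffices ∀ s : Finset ι, f (s.piecewise (fun i => F (v i)) v) = f v by
    simpa using this Finset.univ
  intro s
  induction s using Finset.induction_on with
  | empty => simp
  | insert a s ha ih =>
    rw [Finset.piecewise_insert, ← ih, ← h (s.piecewise (fun i => F (v i)) v) a]
    congr 2
    rw [Finset.piecewise_eq_of_notMem _ _ _ ha]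

/-- The multilinear extension of `clsTuple` to linear combinations of trees. -/
def clsTupleForm (m n : ℕ) :
    MultilinearMap ℚ (fun _ : Fin n => FreeNonUnitalNonAssocAlgebra ℚ (Fin m)) (LieHom m n) :=
  ((Basis.piTensorProduct fun _ : Fin n =>
    MonoidAlgebra.basis (FreeMagma (Fin m)) ℚ).constr ℚ clsTuple).compMultilinearMap
      (PiTensorProduct.tprod ℚ)

lemma clsTupleForm_single {m n : ℕ} (p : Fin n → FreeMagma (Fin m)) :
    clsTupleForm m n (fun i => MonoidAlgebra.single (p i) 1) = clsTuple p := by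
  have := (Basis.piTensorProduct fun _ : Fin n =>
    MonoidAlgebra.basis (FreeMagma (Fin m)) ℚ).constr_basis ℚ clsTuple p
  rw [Basis.piTensorProduct_apply] at this
  exact this

lemma clsTupleForm_update_single {m n : ℕ} (p : Fin n → FreeMagma (Fin m)) (i : Fin n)
    (x : FreeNonUnitalNonAssocAlgebra ℚ (Fin m)) :
    clsTupleForm m n (Function.update (fun i => MonoidAlgebra.single (p i) 1) i x) =
      ctxHom (Forest.one n) p i x := by
  induction x using freeNonAssoc_induction with
  | zero => rw [MultilinearMap.map_update_zero, map_zero]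
  | add x y hx hy => rw [MultilinearMap.map_update_add, map_add, hx, hy]
  | smul r x hx => rw [MultilinearMap.map_update_smul, map_smul, hx]
  | tree T =>
    rw [ctxHom_single]
    have : (Function.update (fun i => MonoidAlgebra.single (p i) (1 : ℚ)) i
        (MonoidAlgebra.single T 1)) =
        fun j => MonoidAlgebra.single (Function.update p i T j) 1 := by
      funext j
      by_cases hj : j = i
      · subst hj
        simp
      · simp [hj]
    rw [this, clsTupleForm_single]
    rfl

/-- By multilinearity the other slots may be taken to be single trees; then the form is `ctxHom` in
slot `i`, which kills the kernel of the quotient map to the free Lie algebra. -/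
lemma clsTupleForm_update_eq_zero {m n : ℕ}
    (E : FreeNonUnitalNonAssocAlgebra ℚ (Fin m) →ₗ[ℚ] FreeNonUnitalNonAssocAlgebra ℚ (Fin m))
    (hE : ∀ x, toFreeLie (Fin m) (E x) = 0)
    (v : Fin n → FreeNonUnitalNonAssocAlgebra ℚ (Fin m)) (i : Fin n) :
    clsTupleForm m n (Function.update v i (E (v i))) = 0 := by
  have : (clsTupleForm m n).compLinearMap (Function.update (fun _ => LinearMap.id) i E) = 0 := by
    refine Module.Basis.ext_multilinear
      (fun _ => MonoidAlgebra.basis (FreeMagma (Fin m)) ℚ) fun p => ?_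
    rw [MultilinearMap.compLinearMap_apply, zero_apply,
      ← ctxHom_eq_zero (hE (MonoidAlgebra.single (p i) 1)) (Forest.one n) p i,
      ← clsTupleForm_update_single]
    congr 1
    funext j
    by_cases hj : j = i
    · subst hj
      simp
    · simp [hj]
  have h := congrArg (fun f => f v) this
  simp only [MultilinearMap.compLinearMap_apply, zero_apply] at h
  rw [← h]
  congr 1
  funext j
  by_cases hj : j = i
  · subst hj
    simp
  · simp [hj]

/-- A multilinear map on the free Lie algebra retracting the evaluation of forests. -/
lemma exists_clsForm (m n : ℕ) :
    ∃ Φ : MultilinearMap ℚ (fun _ : Fin n => FreeLieAlgebra ℚ (Fin m)) (LieHom m n),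
      ∀ f : Forest m n, Φ (fun j => evalTree (FreeLieAlgebra.of ℚ) (f.tree j)) = cls f := by
  -- A merely linear section suffices: the choice of lift does not affect the form.
  obtain ⟨s, hs⟩ := (toFreeLie (Fin m)).exists_rightInverse_of_surjective
    (LinearMap.range_eq_top.2 toFreeLie_surjective)
  refine ⟨(clsTupleForm m n).compLinearMap fun _ => s, fun f => ?_⟩
  rw [← clsTuple_tree, ← clsTupleForm_single, MultilinearMap.compLinearMap_apply]
  simp only [← toFreeLie_single]
  refine (clsTupleForm m n).map_comp_eq_of_update_eq (fun x => s (toFreeLie (Fin m) x))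
    (fun v i => ?_) fun j => MonoidAlgebra.single (f.tree j) 1
  -- The difference between an element and its chosen lift lies in the kernel of the quotient map.
  have h := clsTupleForm_update_eq_zero (LinearMap.id - s.comp (toFreeLie (Fin m)))
    (fun x => by
      have := LinearMap.congr_fun hs (toFreeLie (Fin m) x)
      simp only [LinearMap.comp_apply, LinearMap.id_apply] at this
      simp [this]) v i
  rw [LinearMap.sub_apply, MultilinearMap.map_update_sub, sub_eq_zero, LinearMap.id_apply,
    Function.update_eq_self] at h
  exact h.symm

/-! ### Tensor powers of a Lie algebra, and cocycles on free Lie algebras -/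

section tensorPower

open scoped TensorProduct

variable {L : Type} [LieRing L] [LieAlgebra ℚ L] {n : ℕ}

/-- The adjoint action on the `n`-th tensor power, as a linear map. -/
def tensorAdAux (L : Type) [LieRing L] [LieAlgebra ℚ L] (n : ℕ) :
    L →ₗ[ℚ] Module.End ℚ (⨂[ℚ] _ : Fin n, L) :=
  ∑ i, ((PiTensorProduct.mapMultilinear ℚ (fun _ : Fin n => L) (fun _ => L)).toLinearMap
    (fun _ => LinearMap.id) i).comp (LieAlgebra.ad ℚ L : L →ₗ[ℚ] Module.End ℚ L)

lemma tensorAdAux_tprod (x : L) (w : Fin n → L) :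
    tensorAdAux L n x (PiTensorProduct.tprod ℚ w) =
      ∑ i, PiTensorProduct.tprod ℚ (Function.update w i ⁅x, w i⁆) := by
  simp only [tensorAdAux, LinearMap.sum_apply, LinearMap.comp_apply,
    MultilinearMap.toLinearMap_apply, PiTensorProduct.mapMultilinear_apply]
  refine Finset.sum_congr rfl fun i _ => ?_
  rw [PiTensorProduct.map_tprod]
  congr 1
  funext j
  by_cases hj : j = i
  · subst hj
    simp
  · simp [hj]

/-- The adjoint action on the `n`-th tensor power of a Lie algebra. -/
def tensorAd (L : Type) [LieRing L] [LieAlgebra ℚ L] (n : ℕ) :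
    L →ₗ⁅ℚ⁆ Module.End ℚ (⨂[ℚ] _ : Fin n, L) where
  __ := tensorAdAux L n
  map_lie' {x y} := by
    change tensorAdAux L n ⁅x, y⁆ = ⁅tensorAdAux L n x, tensorAdAux L n y⁆
    refine PiTensorProduct.ext (MultilinearMap.ext fun w => ?_)
    simp only [LinearMap.compMultilinearMap_apply, Ring.lie_def, LinearMap.sub_apply,
      Module.End.mul_apply, tensorAdAux_tprod, map_sum]
    -- After one double sum is transposed, actions in distinct slots commute and cancel; the
    -- diagonal terms combine by the Jacobi identity.
    rw [Finset.sum_comm (f := fun i j => PiTensorProduct.tprod ℚ (Function.update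
      (Function.update w i ⁅x, w i⁆) j ⁅y, Function.update w i ⁅x, w i⁆ j⁆)),
      ← Finset.sum_sub_distrib]
    refine Finset.sum_congr rfl fun i _ => ?_
    rw [← Finset.sum_sub_distrib, Finset.sum_eq_single i]
    · simp only [Function.update_self, Function.update_idem]
      rw [← MultilinearMap.map_update_sub, lie_lie]
    · intro j _ hj
      rw [Function.update_of_ne hj, Function.update_of_ne hj.symm, Function.update_comm hj,
        sub_self]
    · simp

lemma tensorAd_tprod (x : L) (w : Fin n → L) :
    tensorAd L n x (PiTensorProduct.tprod ℚ w) =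
      ∑ i, PiTensorProduct.tprod ℚ (Function.update w i ⁅x, w i⁆) :=
  tensorAdAux_tprod x w

end tensorPower

/-- On a free Lie algebra, linear maps `θ a` given on the generators extend to a 1-cocycle with
values in the linear maps from a module to a trivial module. -/
lemma exists_cocycle {α N Q : Type} [AddCommGroup N] [Module ℚ N] [AddCommGroup Q] [Module ℚ Q]
    (ρ : FreeLieAlgebra ℚ α →ₗ⁅ℚ⁆ Module.End ℚ N) (θ : α → N →ₗ[ℚ] Q) :
    ∃ h : FreeLieAlgebra ℚ α →ₗ[ℚ] N →ₗ[ℚ] Q, (∀ a, h (FreeLieAlgebra.of ℚ a) = θ a) ∧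
      ∀ x y w, h ⁅x, y⁆ w = h x (ρ y w) - h y (ρ x w) := by
  -- A cocycle of this kind is the off-diagonal block of a representation on `N × Q` with diagonal
  -- blocks `ρ` and `0`. Freeness gives the representation once the generators are assigned `(ρ,
  -- θ)`.
  set X : FreeLieAlgebra ℚ α →ₗ⁅ℚ⁆ Module.End ℚ (N × Q) := FreeLieAlgebra.lift ℚ fun a =>
    ((ρ (FreeLieAlgebra.of ℚ a)).prod (θ a)).comp (LinearMap.fst ℚ N Q) with hX
  have hof (a : α) (z : N × Q) :
      X (FreeLieAlgebra.of ℚ a) z = (ρ (FreeLieAlgebra.of ℚ a) z.1, θ a z.1) := by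
    rw [hX, FreeLieAlgebra.lift_of_apply]
    rfl
  -- The block-triangular shape is visible on generators and is preserved by brackets.
  have hfst (x : FreeLieAlgebra ℚ α) :
      (∀ z, (X x z).1 = ρ x z.1) ∧ ∀ q, X x (0, q) = 0 := by
    induction x using freeLie_induction with
    | zero => simp
    | add x y hx hy => simp [hx.1, hy.1, hx.2, hy.2]
    | smul r x hx => simp [hx.1, hx.2]
    | of a => simp [hof]
    | lie x y hx hy =>
      simp [LieHom.map_lie, Ring.lie_def, hx.1, hy.1, hx.2, hy.2]
  have hinl (x : FreeLieAlgebra ℚ α) (z : N × Q) : X x z = X x (z.1, 0) := by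
    have : z = (z.1, 0) + (0, z.2) := by simp
    rw [this, map_add, (hfst x).2]
    simp
  refine ⟨(LinearMap.llcomp ℚ N (N × Q) Q (LinearMap.snd ℚ N Q)).comp
    ((LinearMap.lcomp ℚ (N × Q) (LinearMap.inl ℚ N Q)).comp
      (X : FreeLieAlgebra ℚ α →ₗ[ℚ] Module.End ℚ (N × Q))), fun a => ?_, fun x y w => ?_⟩
  · ext w
    simp [hof]
  · simp only [LinearMap.comp_apply, LinearMap.llcomp_apply, LinearMap.lcomp_apply,
      LinearMap.inl_apply, LinearMap.snd_apply, LieHom.coe_toLinearMap, LieHom.map_lie,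
      Ring.lie_def, LinearMap.sub_apply, Module.End.mul_apply, Prod.snd_sub]
    rw [hinl x, hinl y (X x _), (hfst x).1, (hfst y).1]

/-! ### The homotopy -/

/-- The elements `μ` bracket on the right while `tensorAd` acts on the left, whence the sign. -/
lemma sum_tprod_update_lie {L : Type} [LieRing L] [LieAlgebra ℚ L] {n : ℕ} (x : L)
    (w : Fin n → L) :
    ∑ i, PiTensorProduct.tprod ℚ (Function.update w i ⁅w i, x⁆) =
      -tensorAd L n x (PiTensorProduct.tprod ℚ w) := by
  rw [tensorAd_tprod, ← Finset.sum_neg_distrib]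
  refine Finset.sum_congr rfl fun i _ => ?_
  rw [← MultilinearMap.map_update_neg, lie_skew]

lemma evalTree_mu_graft {L : Type} [LieRing L] {m n : ℕ} (v : Fin m → L) (i : Fin n)
    (f : Forest m (n + 1)) :
    (fun j => evalTree v (((Forest.mu i).graft f).tree j)) =
      Function.update (fun j : Fin n => evalTree v (f.tree j.castSucc)) i
        ⁅evalTree v (f.tree i.castSucc), evalTree v (f.tree (Fin.last n))⁆ := by
  funext j
  rw [Forest.graft_tree, mu_tree]
  by_cases hj : j = i
  · subst hj
    simp
  · simp [hj]

lemma evalTree_shift_mu_graft {L : Type} [LieRing L] {m n : ℕ} (v : Fin m → L) (i : Fin n)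
    (f : Forest m (n + 1 + 1)) :
    (fun j => evalTree v (((Forest.mu i).shift.graft f).tree j)) =
      Fin.snoc (α := fun _ => L)
        (Function.update (fun j : Fin n => evalTree v (f.tree j.castSucc.castSucc)) i
          ⁅evalTree v (f.tree i.castSucc.castSucc),
            evalTree v (f.tree (Fin.last n).castSucc)⁆)
        (evalTree v (f.tree (Fin.last (n + 1)))) := by
  funext j
  refine Fin.lastCases ?_ (fun j => ?_) j
  · simp
  · rw [Forest.graft_tree, Forest.shift_castSucc, mu_tree, Fin.snoc_castSucc]
    by_cases hj : j = i
    · subst hj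
      simp
    · simp [hj]

/-- On `δ⁽¹⁾CatLie(m, n + 1)` the action of `μ(n) ⊠ 1` factors through the differential. -/
lemma exists_homotopy (m n : ℕ) :
    ∃ κ : LieHom m (n + 1) →ₗ[ℚ] LieHom m (n + 1), ∀ y ∈ deltaOneSub m (n + 1),
      κ (comp _ _ _ y (mu (n + 1))) = comp _ _ _ y (shiftHom _ _ (mu n)) := by
  obtain ⟨Φ, hΦ⟩ := exists_clsForm m (n + 1)
  -- On a generator `a`, the cocycle places `a` as the last tree after the `n` tensor factors.
  obtain ⟨h, hof, hlie⟩ := exists_cocycle (tensorAd (FreeLieAlgebra ℚ (Fin m)) n)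
    fun a => (PiTensorProduct.lift Φ.curryRight).flip (FreeLieAlgebra.of ℚ a)
  refine ⟨evalHom (FreeLieAlgebra.of ℚ)
    (h.flip.compMultilinearMap (PiTensorProduct.tprod ℚ)).uncurryRight, fun y hy => ?_⟩
  induction hy using Submodule.span_induction with
  | zero => simp
  | add x x' _ _ h h' => simp only [map_add, LinearMap.add_apply, h, h']
  | smul r x _ h => simp only [map_smul, LinearMap.smul_apply, h]
  | mem y hy =>
    obtain ⟨f, ⟨a, ha⟩, rfl⟩ := hy
    simp only [mu, map_sum, comp_cls, shiftHom_cls, evalHom_cls]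
    simp only [← hΦ, evalTree_mu_graft, evalTree_shift_mu_graft, ha, evalTree_of]
    set w : Fin n → FreeLieAlgebra ℚ (Fin m) :=
      fun j => evalTree (FreeLieAlgebra.of ℚ) (f.tree j.castSucc.castSucc)
    set b := evalTree (FreeLieAlgebra.of ℚ) (f.tree (Fin.last n).castSucc)
    have hl (i : Fin n) (x : FreeLieAlgebra ℚ (Fin m)) :
        Φ (Fin.snoc (α := fun _ => FreeLieAlgebra ℚ (Fin m)) (Function.update w i ⁅w i, b⁆) x) =
          (PiTensorProduct.lift Φ.curryRight).flip x
            (PiTensorProduct.tprod ℚ (Function.update w i ⁅w i, b⁆)) := by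
      simp
    have hc (i : Fin n) (x : FreeLieAlgebra ℚ (Fin m)) :
        Fin.init (Function.update (fun j : Fin (n + 1) =>
          evalTree (FreeLieAlgebra.of ℚ) (f.tree j.castSucc)) i.castSucc x) =
          Function.update w i x := by
      funext j
      by_cases hj : j = i
      · subst hj
        simp [Fin.init]
      · simp [Fin.init, hj, w]
    have hi (x : FreeLieAlgebra ℚ (Fin m)) :
        Fin.init (Function.update (fun j : Fin (n + 1) =>
          evalTree (FreeLieAlgebra.of ℚ) (f.tree j.castSucc)) (Fin.last n) x) = w := by
      funext j
      simp [Fin.init, w]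
    -- The last summand of the differential, the one bracketing `b` with `a`, is where the cocycle
    -- rule applies.
    rw [Fin.sum_univ_castSucc]
    simp only [MultilinearMap.uncurryRight_apply, LinearMap.compMultilinearMap_apply,
      LinearMap.flip_apply h, hc, hi, Function.update_self,
      Function.update_of_ne (Fin.castSucc_lt_last _).ne']
    have key : ∑ i, h b (PiTensorProduct.tprod ℚ (Function.update w i
          ⁅w i, FreeLieAlgebra.of ℚ a⁆)) +
        h ⁅b, FreeLieAlgebra.of ℚ a⁆ (PiTensorProduct.tprod ℚ w) =
        ∑ i, Φ (Fin.snoc (α := fun _ => FreeLieAlgebra ℚ (Fin m)) (Function.update w i ⁅w i, b⁆)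
          (FreeLieAlgebra.of ℚ a)) := by
      simp only [hl]
      rw [← map_sum (h b), ← map_sum ((PiTensorProduct.lift Φ.curryRight).flip _),
        sum_tprod_update_lie, sum_tprod_update_lie, hlie, ← hof, map_neg, map_neg]
      abel
    exact key

/-! ### The homology in degree one -/

/-- Only additivity needs checking: additive functors between `ℚ`-linear categories are `ℚ`-linear.
-/
lemma deltaOne_isLeftModule (m : CatLie) : IsLeftModule (deltaOne m) := by
  have : (deltaOne m).Additive := ⟨fun {X Y f g} => by
    ext x
    refine Subtype.ext ?_
    change comp _ _ _ x.1 (shiftHom _ _ (f + g)) =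
      comp _ _ _ x.1 (shiftHom _ _ f) + comp _ _ _ x.1 (shiftHom _ _ g)
    rw [← map_add]
    exact congrArg _ (map_add (shiftHom X.arity Y.arity) f g)⟩
  exact ⟨this, inferInstance⟩

lemma IsLeftModule.of_mono {M N : CatLie ⥤ ModuleCat.{0} ℚ} (i : M ⟶ N) [Mono i]
    (h : IsLeftModule N) : IsLeftModule M := by
  have := h.1
  have : M.Additive := ⟨fun {X Y f g} => by
    rw [← cancel_mono (i.app Y), Preadditive.add_comp]
    simp only [NatTrans.naturality, Functor.map_add, Preadditive.comp_add]⟩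
  exact ⟨this, inferInstance⟩

lemma IsLeftModule.of_epi {M N : CatLie ⥤ ModuleCat.{0} ℚ} (p : M ⟶ N) [Epi p]
    (h : IsLeftModule M) : IsLeftModule N := by
  have := h.1
  have : N.Additive := ⟨fun {X Y f g} => by
    rw [← cancel_epi (p.app X), Preadditive.comp_add]
    simp only [← NatTrans.naturality, Functor.map_add, Preadditive.add_comp]⟩
  exact ⟨this, inferInstance⟩

instance epi_delta_map {M N : CatLie ⥤ ModuleCat.{0} ℚ} (p : M ⟶ N) [Epi p] :
    Epi (delta.map p) := by
  rw [NatTrans.epi_iff_epi_app]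
  intro n
  exact inferInstanceAs (Epi (p.app (shift.obj n)))

/-- The map `μ̃` vanishes on the kernel of the differential. -/
lemma muTilde_app_deltaOne_apply (m n : CatLie) (y : (deltaOne m).obj (shift.obj n))
    (hy : (muTildeOne m).app (shift.obj n) y = 0) :
    (muTilde.app (deltaOne m)).app n y = 0 := by
  obtain ⟨κ, hκ⟩ := exists_homotopy m.arity n.arity
  refine Subtype.ext ?_
  change comp _ _ _ y.1 (shiftHom _ _ (mu n.arity)) = 0
  have hy' : comp _ _ _ y.1 (mu (n.arity + 1)) = 0 := hy
  exact (hκ y.1 y.2).symm.trans ((congrArg κ hy').trans (map_zero κ))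

/-- Naturality of `muTilde` along the monomorphism `i` transfers the vanishing from the kernel of
the differential to `Z`. -/
lemma muTilde_app_eq_zero_of_comp {m : CatLie} {Z : CatLie ⥤ ModuleCat.{0} ℚ}
    (i : Z ⟶ deltaOne m) [Mono i] (hi : i ≫ muTildeOne m = 0) : muTilde.app Z = 0 := by
  rw [← cancel_mono i, Limits.zero_comp]
  have hn := muTilde.naturality i
  refine hn.symm.trans ?_
  ext n z
  refine muTilde_app_deltaOne_apply m n (i.app (shift.obj n) z) ?_
  have := congrArg (fun φ => φ.app (shift.obj n) z) hi
  exact this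

lemma exists_iso_cLie (m : CatLie) :
    ∃ (e₁ : (cLie m).X 1 ≅ deltaOne m) (e₀ : (cLie m).X 0 ≅ catLieLeft m),
      (cLie m).d 1 0 = e₁.hom ≫ muTildeOne m ≫ e₀.inv :=
  ⟨HomologicalComplex.doubleXIso₀ _ _, HomologicalComplex.doubleXIso₁ _ _ one_ne_zero,
    HomologicalComplex.double_d _ _ one_ne_zero⟩

lemma homologyLie_one_FLieMu (m : CatLie) : FLieMu (homologyLie 1 m) := by
  obtain ⟨e₁, e₀, hd⟩ := exists_iso_cLie m
  let i : (cLie m).cycles 1 ⟶ deltaOne m := (cLie m).iCycles 1 ≫ e₁.hom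
  have hi : i ≫ muTildeOne m = 0 := by
    have h := (cLie m).iCycles_d 1 0
    rw [hd] at h
    rw [← cancel_mono e₀.inv, Limits.zero_comp]
    simpa only [i, Category.assoc] using h
  have : Mono i := mono_comp _ _
  let p : (cLie m).cycles 1 ⟶ homologyLie 1 m := (cLie m).homologyπ 1
  have : Epi p := inferInstanceAs (Epi ((cLie m).homologyπ 1))
  refine ⟨((deltaOne_isLeftModule m).of_mono i).of_epi p, ?_⟩
  -- `delta` preserves epimorphisms, since these are detected objectwise, so vanishing on cycles
  -- passes to homology.
  rw [← cancel_epi (delta.map p), Limits.comp_zero]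
  exact (muTilde.naturality p).trans (by
    rw [muTilde_app_eq_zero_of_comp i hi, Limits.zero_comp])

end LieProp

end

theorem mainTheorem2 (m : LieProp.CatLie) : LieProp.FLieMu (LieProp.homologyLie 1 m) :=
  LieProp.homologyLie_one_FLieMu m
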